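/- Let $X$ be a smooth irreducible affine algebraic variety over $\mathbb C$ with algebra of regular functions $\mathbb C[X]$, and suppose that $X$ is homogeneous, i.e. the group $\operatorname{Aut} X$ of algebraic automorphisms of $X$ acts transitively on $X$. Algebraic vector fields on $X$ are identified with $\mathbb C$-derivations of $\mathbb C[X]$. Such a field is called completely integrable if through every point of $X$ there passes an integral curve defined for all complex times, locally nilpotent if for every $f\in\mathbb C[X]$ some power of it annihilates $f$, and semi-simple if its phase flow generates an algebraic $\mathbb C^*$-action on $X$ (the flow at time $t$ is the action of $e^{ct}$, for some constant $c\neq 0$). Let $\operatorname{VF}_{\rm alg}(X)$ be the Lie algebra of all algebraic vector fields on $X$, and $\operatorname{Lie}_{\rm alg}(X)$ the complex Lie subalgebra generated by the completely integrable ones. A pair $(\delta_1,\delta_2)$ of nonzero algebraic vector fields on $X$, where $\delta_1$ is locally nilpotent and $\delta_2$ is locally nilpotent or semi-simple, is called compatible if (i) the linear span of all products $f_1f_2$ with $f_1\in\operatorname{Ker}\delta_1$, $f_2\in\operatorname{Ker}\delta_2$ contains a nonzero ideal of $\mathbb C[X]$, and (ii) there is $a\in\operatorname{Ker}\delta_2$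 with $\delta_1(a)\in\operatorname{Ker}\delta_1\setminus\{0\}$. A finite set $M\subset T_{x_0}X$ is called a generating set if the images of the elements of $M$ under the differentials at $x_0$ of all $\alpha\in\operatorname{Aut}X$ with $\alpha(x_0)=x_0$ span the vector space $T_{x_0}X$. **Theorem.** Let $m\ge 1$, let $(\delta_1^k,\delta_2^k)$, $k=1,\dots,m$, be compatible pairs of algebraic vector fields on $X$, and suppose that for some point $x_0\in X$ the vectors $\delta_2^1(x_0),\dots,\delta_2^m(x_0)$ form a generating set. Then $\operatorname{Lie}_{\rm alg}(X)$ contains a nonzero $\mathbb C[X]$-submodule of $\operatorname{VF}_{\rm alg}(X)$, and $X$ has the algebraic density property, i.e. $\operatorname{Lie}_{\rm alg}(X)=\operatorname{VF}_{\rm alg}(X)$. -/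

import Mathlib

open scoped LaurentPolynomial

/-! An affine algebraic variety `X` over `ℂ` is represented by its algebra of regular functions
`A = ℂ[X]`, an arbitrary finitely generated `ℂ`-algebra. -/

namespace AffineDensity

/-- The (closed) points of `X`: a point `x` is identified with the evaluation `f ↦ f(x)`. -/
abbrev Point (A : Type*) [CommRing A] [Algebra ℂ A] : Type _ := A →ₐ[ℂ] ℂ

/-- Algebraic vector fields on `X`: derivations of the algebra of regular functions. -/
abbrev VFalg (A : Type*) [CommRing A] [Algebra ℂ A] : Type _ := Derivation ℂ A A

/-- Algebraic automorphisms of `X`. An automorphism `α` of `X` is represented by its comorphism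
`f ↦ f ∘ α`, an automorphism of the algebra of regular functions. -/
abbrev AutX (A : Type*) [CommRing A] [Algebra ℂ A] : Type _ := A ≃ₐ[ℂ] A

variable {A : Type*} [CommRing A] [Algebra ℂ A]

/-- The image `α(x)` of the point `x` under the automorphism `α`: one has `f(α(x)) = (f ∘ α)(x)`. -/
def act (α : AutX A) (x : Point A) : Point A := x.comp (α : A →ₐ[ℂ] A)

variable (A) in
/-- `X` is homogeneous: the group of algebraic automorphisms acts transitively on points. -/
def IsHomogeneous : Prop := ∀ x y : Point A, ∃ α : AutX A, act α x = y

/-- The tangent space `T_x X`: all linear functionals `v` on `ℂ[X]` that satisfy the Leibniz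
rule at `x`. -/
def tangentSpace (x : Point A) : Submodule ℂ (A →ₗ[ℂ] ℂ) where
  carrier := {v | ∀ f g : A, v (f * g) = x f * v g + x g * v f}
  add_mem' := by
    intro v w hv hw f g
    simp only [LinearMap.add_apply, hv f g, hw f g]
    ring
  zero_mem' := by
    intro f g
    simp
  smul_mem' := by
    intro c v hv f g
    simp only [LinearMap.smul_apply, hv f g, smul_eq_mul]
    ring

/-- The value `δ(x) ∈ T_x X` of a vector field at a point, `f ↦ (δ f)(x)`. -/
def valueAt (δ : VFalg A) (x : Point A) : tangentSpace x :=
  ⟨x.toLinearMap.comp (δ : A →ₗ[ℂ] A), by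
    intro f g
    simp [Derivation.leibniz]⟩

/-- The differential `dα_x : T_x X → T_{α(x)} X` of an automorphism, `(dα_x v)(f) = v(f ∘ α)`. -/
def differential (α : AutX A) (x : Point A) : tangentSpace x →ₗ[ℂ] tangentSpace (act α x) where
  toFun v := ⟨v.1.comp (α : A →ₐ[ℂ] A).toLinearMap, by
    intro f g
    have h := v.2 (α f) (α g)
    simpa [act] using h⟩
  map_add' _ _ := rfl
  map_smul' _ _ := rfl

/-- A finite set `M` of tangent vectors at `x` is a generating set if the images of its elements
under (the differentials of) the automorphisms that fix `x` span `T_x X`. -/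
def IsGeneratingSet (x : Point A) (M : Set (tangentSpace x)) : Prop :=
  M.Finite ∧
    Submodule.span ℂ {w : tangentSpace x | ∃ α : AutX A, act α x = x ∧
      ∃ v ∈ M, (w : A →ₗ[ℂ] ℂ) = (differential α x v : A →ₗ[ℂ] ℂ)} = ⊤

/-- `γ : ℂ → X` is an entire integral curve of `δ`: for every regular function `f`,
`d/dt f(γ(t)) = (δ f)(γ(t))`. -/
def IsIntegralCurve (δ : VFalg A) (γ : ℂ → Point A) : Prop :=
  ∀ (f : A) (t : ℂ), HasDerivAt (fun s : ℂ => γ s f) (γ t (δ f)) t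

/-- `δ` is completely integrable: through every point there passes an integral curve that is
defined for all complex times. -/
def IsCompletelyIntegrable (δ : VFalg A) : Prop :=
  ∀ x : Point A, ∃ γ : ℂ → Point A, γ 0 = x ∧ IsIntegralCurve δ γ

variable (A) in
/-- `Lie_alg(X)`: the complex Lie algebra generated by the completely integrable algebraic vector
fields. -/
def LieAlg : LieSubalgebra ℂ (VFalg A) :=
  LieSubalgebra.lieSpan ℂ (VFalg A) {δ | IsCompletelyIntegrable δ}

variable (A) in
/-- The algebraic density property: `Lie_alg(X)` consists of all algebraic vector fields. -/
def AlgebraicDensityProperty : Prop := LieAlg A = ⊤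

/-- `δ` is a locally nilpotent derivation. -/
def IsLocallyNilpotent (δ : VFalg A) : Prop :=
  ∀ f : A, ∃ n : ℕ, ((δ : A →ₗ[ℂ] A) ^ n) f = 0

/-- An action of `ℂ^*` on `X` by automorphisms is algebraic if for every regular function `f` the
function `(s, x) ↦ f(s · x)` is regular on `ℂ^* × X`, that is, a Laurent polynomial in `s`
with coefficients in `ℂ[X]`. -/
def IsAlgebraicAction (lam : ℂˣ →* AutX A) : Prop :=
  ∀ f : A, ∃ p : A[T;T⁻¹], ∀ s : ℂˣ,
    lam s f = ∑ n ∈ p.coeff.support, ((s ^ n : ℂˣ) : ℂ) • p.coeff n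

/-- `δ` is semi-simple: its phase flow generates an algebraic action of `ℂ^*`, that is, the flow
at time `t` is the action of `exp (c t)` for some algebraic action of `ℂ^*` and some nonzero
constant `c`. -/
def IsSemisimpleField (δ : VFalg A) : Prop :=
  ∃ lam : ℂˣ →* AutX A, IsAlgebraicAction lam ∧ ∃ c : ℂ, c ≠ 0 ∧ ∀ x : Point A,
    IsIntegralCurve δ (fun t : ℂ => act (lam (Units.mk0 (Complex.exp (c * t))
      (Complex.exp_ne_zero (c * t)))) x)

/-- Compatible pairs of vector fields. The product of the two kernels is the product of
`ℂ`-subspaces of `ℂ[X]`, the span of all `f * g` with `δ₁ f = 0` and `δ₂ g = 0`. -/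
structure Compatible (δ₁ δ₂ : VFalg A) : Prop where
  ne_zero₁ : δ₁ ≠ 0
  ne_zero₂ : δ₂ ≠ 0
  locallyNilpotent₁ : IsLocallyNilpotent δ₁
  locallyNilpotent_or_semisimple₂ : IsLocallyNilpotent δ₂ ∨ IsSemisimpleField δ₂
  exists_ideal : ∃ I : Ideal A, I ≠ ⊥ ∧
    ∀ h ∈ I, h ∈ LinearMap.ker (δ₁ : A →ₗ[ℂ] A) * LinearMap.ker (δ₂ : A →ₗ[ℂ] A)
  exists_degree_one : ∃ a : A, δ₂ a = 0 ∧ δ₁ a ≠ 0 ∧ δ₁ (δ₁ a) = 0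

end AffineDensity

namespace AffineDensity

variable {A : Type*} [CommRing A] [Algebra ℂ A]

open Polynomial

/-! A compatible pair yields a nonzero multiple of `δ₂` all of whose `A`-multiples lie in `LieAlg
A`. If `δ₂ a = 0` and `δ₁ (δ₁ a) = 0`, the fields `f₁ δ₁`, `a f₁ δ₁`, `f₂ δ₂`, `a f₂ δ₂` with `fᵢ`
in the kernel of `δᵢ` are completely integrable, and two brackets of them differ by `δ₁ a * (f₁ *
f₂)` times `δ₂` (`Compatible.mul_smul_mem_lieAlg`). Since the products `f₁ * f₂` span a space
containing a nonzero ideal, a nonzero multiple of `δ₂` lies in `lieCore A`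
(`Compatible.exists_smul_mem_lieCore`).

Automorphisms preserve `LieAlg A`, so transported copies of the `δ₂` have such multiples too. By the
generating set condition these copies span the tangent space at `x₀`. Nakayama's lemma then makes
them generate all fields near `x₀`, and clearing denominators gives one nonzero function carrying
every field into the core (`conductor_ne_bot`). Such functions form an ideal stable under
automorphisms. On a homogeneous variety its zero set is empty, so it contains 1
(`lieCore_eq_top_of_conductor_ne_bot`). -/

/-! ### Points and maximal ideals -/

/-- The weak Nullstellensatz: a proper ideal has a zero. -/
theorem exists_point_of_ne_top [Algebra.FiniteType ℂ A] {I : Ideal A} (hI : I ≠ ⊤) :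
    ∃ x : Point A, ∀ f ∈ I, x f = 0 := by
  obtain ⟨m, hm, hIm⟩ := Ideal.exists_le_maximal I hI
  let : Field (A ⧸ m) := Ideal.Quotient.field m
  have : Module.Finite ℂ (A ⧸ m) := finite_of_finite_type_of_isJacobsonRing ℂ (A ⧸ m)
  let e : ℂ ≃ₐ[ℂ] (A ⧸ m) :=
    AlgEquiv.ofBijective (Algebra.ofId ℂ (A ⧸ m)) IsAlgClosed.algebraMap_bijective_of_isIntegral
  refine ⟨(e.symm : (A ⧸ m) →ₐ[ℂ] ℂ).comp (Ideal.Quotient.mkₐ ℂ m), fun f hf => ?_⟩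
  have : Ideal.Quotient.mk m f = 0 := Ideal.Quotient.eq_zero_iff_mem.mpr (hIm hf)
  simp [this]

/-- A function on an affine variety that vanishes at all points is zero. -/
theorem eq_zero_of_forall_point [IsDomain A] [Algebra.FiniteType ℂ A] {f : A}
    (hf : ∀ x : Point A, x f = 0) : f = 0 := by
  have hJ : IsJacobsonRing A := isJacobsonRing_of_finiteType (A := ℂ)
  have hbot : (⊥ : Ideal A).jacobson = ⊥ :=
    hJ.out (Ideal.isRadical_iff_quotient_reduced _ |>.mpr inferInstance)
  suffices f ∈ (⊥ : Ideal A).jacobson by rwa [hbot, Ideal.mem_bot] at this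
  rw [Ideal.mem_jacobson_bot]
  intro y
  by_contra hu
  -- A zero of `f * y + 1` is a point where `f` cannot vanish.
  obtain ⟨x, hx⟩ := exists_point_of_ne_top (I := Ideal.span {f * y + 1})
    (by rwa [Ne, Ideal.span_singleton_eq_top])
  have := hx _ (Ideal.mem_span_singleton_self _)
  simp [hf x] at this

/-- On a homogeneous variety an ideal that is stable under all automorphisms is trivial. -/
theorem eq_top_of_isHomogeneous [IsDomain A] [Algebra.FiniteType ℂ A] (homog : IsHomogeneous A)
    {I : Ideal A} (hI : I ≠ ⊥) (hstable : ∀ (α : AutX A), ∀ f ∈ I, α f ∈ I) : I = ⊤ := by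
  by_contra htop
  obtain ⟨x, hx⟩ := exists_point_of_ne_top htop
  refine hI (eq_bot_iff.mpr fun f hf => (Ideal.mem_bot).mpr (eq_zero_of_forall_point fun y => ?_))
  obtain ⟨α, rfl⟩ := homog x y
  exact hx _ (hstable α f hf)

/-! ### Integral curves -/

theorem IsIntegralCurve.apply_eq {δ : VFalg A} {γ : ℂ → Point A} (h : IsIntegralCurve δ γ)
    {f : A} (hf : δ f = 0) (t : ℂ) : γ t f = γ 0 f := by
  refine is_const_of_deriv_eq_zero (f := fun s => γ s f) (fun s => (h f s).differentiableAt)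
    (fun s => ?_) t 0
  rw [(h f s).deriv, hf, map_zero]

theorem IsIntegralCurve.apply_eq_add {δ : VFalg A} {γ : ℂ → Point A} (h : IsIntegralCurve δ γ)
    {f : A} (hf : δ (δ f) = 0) (t : ℂ) : γ t f = γ 0 f + γ 0 (δ f) * t := by
  have key : ∀ s, HasDerivAt (fun s => γ s f - γ 0 (δ f) * s) 0 s := fun s => by
    have := (h f s).sub ((hasDerivAt_id s).const_mul (γ 0 (δ f)))
    rw [h.apply_eq hf s, mul_one, sub_self] at this
    exact this
  have := is_const_of_deriv_eq_zero (fun s => (key s).differentiableAt)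
    (fun s => (key s).deriv) t 0
  simp only [mul_zero, sub_zero] at this
  rw [← this]
  ring

/-- Time change: reparametrizing an integral curve of `δ` by a solution of `τ' = f(γ(τ))` gives an
integral curve of `f δ`. -/
theorem IsIntegralCurve.smul {δ : VFalg A} {γ : ℂ → Point A} (h : IsIntegralCurve δ γ)
    {f : A} {τ : ℂ → ℂ} (hτ : ∀ t, HasDerivAt τ (γ (τ t) f) t) :
    IsIntegralCurve (f • δ) (fun t => γ (τ t)) := by
  intro g t
  have := (h g (τ t)).comp t (hτ t)
  rw [mul_comm, ← map_mul] at this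
  exact this

theorem IsCompletelyIntegrable.smul {δ : VFalg A} (h : IsCompletelyIntegrable δ) {f : A}
    (hf : δ f = 0) : IsCompletelyIntegrable (f • δ) := by
  intro x
  obtain ⟨γ, rfl, hγ⟩ := h x
  refine ⟨fun t => γ (γ 0 f * t), by simp, hγ.smul fun t => ?_⟩
  have := (hasDerivAt_id t).const_mul (γ 0 f)
  rw [mul_one] at this
  rw [hγ.apply_eq hf (γ 0 f * t)]
  exact this

/-- This is the time-change equation for a function that is affine in time along the curve. The
exponential solution divides by `d`, hence the separate case. -/
theorem exists_solution_affine (c d : ℂ) :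
    ∃ τ : ℂ → ℂ, τ 0 = 0 ∧ ∀ t, HasDerivAt τ (c + d * τ t) t := by
  by_cases hd : d = 0
  · refine ⟨fun t => c * t, by simp, fun t => ?_⟩
    simpa [hd] using (hasDerivAt_id t).const_mul c
  · refine ⟨fun t => c / d * (Complex.exp (d * t) - 1), by simp, fun t => ?_⟩
    have := ((((hasDerivAt_id t).const_mul d).cexp).sub_const 1).const_mul (c / d)
    simp only [mul_one, id] at this
    refine this.congr_deriv ?_
    field_simp
    ring

theorem IsCompletelyIntegrable.smul_of_degree_one {δ : VFalg A} (h : IsCompletelyIntegrable δ)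
    {f : A} (hf : δ (δ f) = 0) : IsCompletelyIntegrable (f • δ) := by
  intro x
  obtain ⟨γ, rfl, hγ⟩ := h x
  obtain ⟨τ, hτ₀, hτ⟩ := exists_solution_affine (γ 0 f) (γ 0 (δ f))
  refine ⟨fun t => γ (τ t), by simp [hτ₀], hγ.smul fun t => ?_⟩
  rw [hγ.apply_eq_add hf]
  exact hτ t

theorem IsSemisimpleField.isCompletelyIntegrable {δ : VFalg A} (h : IsSemisimpleField δ) :
    IsCompletelyIntegrable δ := by
  obtain ⟨lam, -, c, -, hc⟩ := h
  intro x
  refine ⟨_, ?_, hc x⟩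
  have : Units.mk0 (Complex.exp (c * 0)) (Complex.exp_ne_zero (c * 0)) = 1 := by
    ext; simp
  rw [this, map_one]
  ext f
  simp [act]

/-! ### The flow of a locally nilpotent vector field -/

/-- The value `f(exp(tδ)(x))`, as a polynomial in the time `t`, summed up to degree `n`. -/
noncomputable def flowPoly (δ : VFalg A) (x : Point A) (n : ℕ) (f : A) : ℂ[X] :=
  ∑ i ∈ Finset.range n, monomial i (x (((δ : A →ₗ[ℂ] A) ^ i) f) / (i.factorial : ℂ))

theorem pow_apply_eq_zero_of_le {δ : VFalg A} {f : A} {m n : ℕ} (hmn : m ≤ n)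
    (h : ((δ : A →ₗ[ℂ] A) ^ m) f = 0) : ((δ : A →ₗ[ℂ] A) ^ n) f = 0 := by
  obtain ⟨k, rfl⟩ := Nat.exists_eq_add_of_le' hmn
  rw [pow_add, Module.End.mul_apply, h, map_zero]

theorem flowPoly_eq_of_le {δ : VFalg A} (x : Point A) {f : A} {m n : ℕ} (hmn : m ≤ n)
    (h : ((δ : A →ₗ[ℂ] A) ^ m) f = 0) : flowPoly δ x n f = flowPoly δ x m f := by
  symm
  refine Finset.sum_subset (Finset.range_subset_range.mpr hmn) fun i _ hi => ?_
  rw [pow_apply_eq_zero_of_le (by simpa using hi) h]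
  simp

theorem derivative_flowPoly (δ : VFalg A) (x : Point A) (n : ℕ) (f : A) :
    derivative (flowPoly δ x (n + 1) f) = flowPoly δ x n (δ f) := by
  rw [flowPoly, Finset.sum_range_succ', map_add, map_sum, flowPoly]
  simp only [derivative_monomial, Nat.cast_zero, mul_zero, map_zero, add_zero]
  refine Finset.sum_congr rfl fun i _ => ?_
  rw [Nat.add_sub_cancel, pow_succ, Module.End.mul_apply, Nat.factorial_succ]
  congr 1
  have : (i.factorial : ℂ) ≠ 0 := by exact_mod_cast i.factorial_ne_zero
  have h' : ((i : ℂ) + 1) ≠ 0 := by exact_mod_cast i.succ_ne_zero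
  push_cast
  field_simp

theorem coeff_zero_flowPoly (δ : VFalg A) (x : Point A) (n : ℕ) (f : A) :
    (flowPoly δ x (n + 1) f).coeff 0 = x f := by
  rw [flowPoly, Finset.sum_range_succ']
  simp [coeff_monomial]

/-- The exponential series terminates on each `f`, at a length depending on `f`. Identities between
different functions are checked at a common, larger truncation. -/
theorem IsLocallyNilpotent.exists_flow {δ : VFalg A} (h : IsLocallyNilpotent δ) (x : Point A) :
    ∃ p : A →ₗ[ℂ] ℂ[X], (∀ f, derivative (p f) = p (δ f)) ∧ ∀ f, (p f).coeff 0 = x f := by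
  have key : ∀ f, ∃ q, ∃ m, ∀ n, m ≤ n → flowPoly δ x n f = q := fun f => by
    obtain ⟨m, hm⟩ := h f
    exact ⟨_, m, fun n hn => flowPoly_eq_of_le x hn hm⟩
  choose p m hp using key
  refine ⟨⟨⟨p, fun f g => ?_⟩, fun c f => ?_⟩, fun f => ?_, fun f => ?_⟩
  · change p (f + g) = p f + p g
    rw [← hp (f + g) (m (f + g) + m f + m g) (by omega), ← hp f (m (f + g) + m f + m g) (by omega),
      ← hp g (m (f + g) + m f + m g) (by omega)]
    simp [flowPoly, add_div, Finset.sum_add_distrib]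
  · change p (c • f) = c • p f
    rw [← hp (c • f) (m (c • f) + m f) (by omega), ← hp f (m (c • f) + m f) (by omega)]
    simp [flowPoly, Finset.smul_sum, smul_monomial, mul_div_assoc]
  · change derivative (p f) = p (δ f)
    rw [← hp f (m f + m (δ f) + 1) (by omega), ← hp (δ f) (m f + m (δ f)) (by omega),
      derivative_flowPoly]
  · change (p f).coeff 0 = x f
    rw [← hp f (m f + 1) (by omega), coeff_zero_flowPoly]

theorem eq_zero_of_derivative_eq_zero {q : ℂ[X]} (hq : derivative q = 0) (h₀ : q.coeff 0 = 0) :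
    q = 0 := by
  rw [eq_C_of_derivative_eq_zero hq, h₀, C_0]

theorem IsLocallyNilpotent.isCompletelyIntegrable {δ : VFalg A} (h : IsLocallyNilpotent δ) :
    IsCompletelyIntegrable δ := by
  intro x
  obtain ⟨p, hp, hp₀⟩ := h.exists_flow x
  have p_algebraMap (c : ℂ) : p (algebraMap ℂ A c) = C c := by
    have hd : derivative (p (algebraMap ℂ A c)) = 0 := by
      rw [hp, Derivation.map_algebraMap, map_zero]
    rw [eq_C_of_derivative_eq_zero hd, hp₀, AlgHom.commutes, Algebra.algebraMap_self_apply]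
  -- Multiplicativity by induction on the sum of the nilpotency orders. The defect vanishes at time
  -- 0, and its derivative is the sum of the defects of `(δ f, g)` and `(f, δ g)`.
  have p_mul : ∀ (N i j : ℕ) (f g : A), i + j = N → ((δ : A →ₗ[ℂ] A) ^ i) f = 0 →
      ((δ : A →ₗ[ℂ] A) ^ j) g = 0 → p (f * g) - p f * p g = 0 := by
    intro N
    induction N with
    | zero =>
      intro i j f g hij hf hg
      obtain ⟨rfl, rfl⟩ : i = 0 ∧ j = 0 := by omega
      simp only [pow_zero, Module.End.one_apply] at hf hg
      simp [hf, hg]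
    | succ N ih =>
      intro i j f g hij hf hg
      rcases i with _ | i
      · simp only [pow_zero, Module.End.one_apply] at hf
        simp [hf]
      rcases j with _ | j
      · simp only [pow_zero, Module.End.one_apply] at hg
        simp [hg]
      refine eq_zero_of_derivative_eq_zero ?_ ?_
      · have h₁ := ih i (j + 1) (δ f) g (by omega) (by simpa [pow_succ] using hf) hg
        have h₂ := ih (i + 1) j f (δ g) (by omega) hf (by simpa [pow_succ] using hg)
        simp only [derivative_sub, derivative_mul, hp, Derivation.leibniz, smul_eq_mul, map_add]
        rw [mul_comm g (δ f)]
        linear_combination h₁ + h₂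
      · simp [mul_coeff_zero, hp₀]
  refine ⟨fun t => AlgHom.mk ⟨⟨⟨fun f => (p f).eval t, ?_⟩, ?_⟩, ?_, ?_⟩ ?_, ?_, ?_⟩
  · have := p_algebraMap 1
    rw [map_one] at this
    simp [this]
  · intro f g
    obtain ⟨i, hi⟩ := h f
    obtain ⟨j, hj⟩ := h g
    have := sub_eq_zero.mp (p_mul _ i j f g rfl hi hj)
    simp [this]
  · simp
  · intro f g
    simp
  · intro c
    simp [p_algebraMap c]
  · ext f
    change (p f).eval 0 = x f
    rw [← coeff_zero_eq_eval_zero, hp₀]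
  · intro f t
    change HasDerivAt (fun s => (p f).eval s) ((p (δ f)).eval t) t
    rw [← hp]
    exact (p f).hasDerivAt t

/-! ### Fields generating a submodule of the Lie algebra -/

variable (A) in
/-- The largest `ℂ[X]`-submodule of `VF_alg(X)` contained in `Lie_alg(X)`. -/
def lieCore : Submodule A (VFalg A) where
  carrier := {δ | ∀ f : A, f • δ ∈ LieAlg A}
  add_mem' h₁ h₂ f := by
    rw [smul_add]
    exact add_mem (h₁ f) (h₂ f)
  zero_mem' f := by
    rw [smul_zero]
    exact zero_mem _
  smul_mem' g δ h f := by
    rw [smul_smul]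
    exact h (f * g)

theorem mem_lieAlg_of_mem_lieCore {δ : VFalg A} (h : δ ∈ lieCore A) : δ ∈ LieAlg A := by
  simpa using h 1

theorem IsCompletelyIntegrable.mem_lieAlg {δ : VFalg A} (h : IsCompletelyIntegrable δ) :
    δ ∈ LieAlg A :=
  LieSubalgebra.subset_lieSpan h

namespace Compatible

variable {δ₁ δ₂ : VFalg A}

theorem isCompletelyIntegrable₂ (h : Compatible δ₁ δ₂) : IsCompletelyIntegrable δ₂ :=
  h.locallyNilpotent_or_semisimple₂.elim (·.isCompletelyIntegrable) (·.isCompletelyIntegrable)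

theorem mul_smul_mem_lieAlg (h : Compatible δ₁ δ₂) {a f₁ f₂ : A} (ha₂ : δ₂ a = 0)
    (ha₁ : δ₁ (δ₁ a) = 0) (hf₁ : δ₁ f₁ = 0) (hf₂ : δ₂ f₂ = 0) :
    (δ₁ a * (f₁ * f₂)) • δ₂ ∈ LieAlg A := by
  have c₁ := h.locallyNilpotent₁.isCompletelyIntegrable
  have c₂ := h.isCompletelyIntegrable₂
  have m₁ : f₁ • δ₁ ∈ LieAlg A := (c₁.smul hf₁).mem_lieAlg
  have m₂ : f₂ • δ₂ ∈ LieAlg A := (c₂.smul hf₂).mem_lieAlg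
  have m₃ : (a * f₁) • δ₁ ∈ LieAlg A :=
    (c₁.smul_of_degree_one (by simp [Derivation.leibniz, hf₁, ha₁])).mem_lieAlg
  have m₄ : (a * f₂) • δ₂ ∈ LieAlg A :=
    (c₂.smul (by simp [Derivation.leibniz, hf₂, ha₂])).mem_lieAlg
  -- Both brackets contain the same multiple of `⁅δ₁, δ₂⁆`. As `δ₂ a = 0`, only the term where `δ₁`
  -- hits `a` survives the subtraction.
  have key : (δ₁ a * (f₁ * f₂)) • δ₂ = ⁅f₁ • δ₁, (a * f₂) • δ₂⁆ - ⁅(a * f₁) • δ₁, f₂ • δ₂⁆ := by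
    ext g
    simp only [Derivation.commutator_apply, Derivation.sub_apply, Derivation.smul_apply,
      Derivation.leibniz, smul_eq_mul, ha₂]
    ring
  rw [key]
  exact sub_mem ((LieAlg A).lie_mem m₁ m₄) ((LieAlg A).lie_mem m₃ m₂)

/-- A compatible pair `(δ₁, δ₂)` produces a nonzero multiple of `δ₂` all of whose multiples lie in
`Lie_alg(X)`. -/
theorem exists_smul_mem_lieCore [IsDomain A] (h : Compatible δ₁ δ₂) :
    ∃ g : A, g ≠ 0 ∧ g • δ₂ ∈ lieCore A := by
  obtain ⟨a, ha₂, ha, ha₁⟩ := h.exists_degree_one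
  obtain ⟨I, hI, hle⟩ := h.exists_ideal
  obtain ⟨g, hg, hg₀⟩ := Submodule.exists_mem_ne_zero_of_ne_bot hI
  refine ⟨δ₁ a * g, mul_ne_zero ha hg₀, fun f => ?_⟩
  have hfg := hle _ (I.mul_mem_left f hg)
  rw [smul_smul, mul_left_comm]
  generalize f * g = w at hfg
  induction hfg using Submodule.mul_induction_on' with
  | mem_mul_mem f₁ h₁ f₂ h₂ =>
    exact h.mul_smul_mem_lieAlg ha₂ ha₁ (LinearMap.mem_ker.mp h₁) (LinearMap.mem_ker.mp h₂)
  | add u _ v _ hu hv =>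
    rw [mul_add, add_smul]
    exact add_mem hu hv

end Compatible

/-! ### Conjugation of vector fields by automorphisms -/

/-- The vector field `δ` transported by the automorphism `α`. -/
def conj (α : AutX A) (δ : VFalg A) : VFalg A :=
  Derivation.mk' ((α.symm : A →ₐ[ℂ] A).toLinearMap ∘ₗ (δ : A →ₗ[ℂ] A) ∘ₗ
    (α : A →ₐ[ℂ] A).toLinearMap) fun f g => by simp

@[simp]
theorem conj_apply (α : AutX A) (δ : VFalg A) (f : A) : conj α δ f = α.symm (δ (α f)) := rfl

theorem IsCompletelyIntegrable.conj {δ : VFalg A} (h : IsCompletelyIntegrable δ) (α : AutX A) :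
    IsCompletelyIntegrable (conj α δ) := by
  intro x
  obtain ⟨γ, hγ₀, hγ⟩ := h (act α.symm x)
  refine ⟨fun t => act α (γ t), ?_, fun f t => ?_⟩
  · ext f
    simp [hγ₀, act]
  · simpa [act] using hγ (α f) t

/-- Transport respects brackets and permutes the completely integrable generators. -/
theorem conj_mem_lieAlg (α : AutX A) {δ : VFalg A} (h : δ ∈ LieAlg A) : conj α δ ∈ LieAlg A := by
  induction h using LieSubalgebra.lieSpan_induction with
  | mem δ hδ => exact (IsCompletelyIntegrable.conj hδ α).mem_lieAlg
  | zero =>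
    convert zero_mem (LieAlg A)
    ext f
    simp
  | smul c δ _ hδ =>
    convert (LieAlg A).smul_mem c hδ
    ext f
    simp
  | add δ η _ _ hδ hη =>
    convert add_mem hδ hη
    ext f
    simp
  | lie δ η _ _ hδ hη =>
    convert (LieAlg A).lie_mem hδ hη
    ext f
    simp [Derivation.commutator_apply]

theorem smul_conj (α : AutX A) (δ : VFalg A) (f : A) : f • conj α δ = conj α (α f • δ) := by
  ext g
  simp

theorem conj_mem_lieCore (α : AutX A) {δ : VFalg A} (h : δ ∈ lieCore A) :
    conj α δ ∈ lieCore A := fun f => by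
  rw [smul_conj]
  exact conj_mem_lieAlg α (h (α f))

theorem conj_conj_symm (α : AutX A) (δ : VFalg A) : conj α (conj α.symm δ) = δ := by
  ext f
  simp

variable (A) in
/-- The ideal of all functions `h` such that every multiple of `h` by a vector field lies in
`Lie_alg(X)`. -/
def conductor : Ideal A := (lieCore A).colon Set.univ

theorem mem_conductor {h : A} : h ∈ conductor A ↔ ∀ δ : VFalg A, h • δ ∈ lieCore A := by
  simp [conductor, Submodule.mem_colon]

/-- Multiply the transported field `conj α δ` by `h`, then transport back: the coefficient becomes
`α h`. -/
theorem map_mem_conductor (α : AutX A) {h : A} (hh : h ∈ conductor A) : α h ∈ conductor A := by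
  rw [mem_conductor] at hh ⊢
  intro δ
  have := conj_mem_lieCore α.symm (hh (conj α δ))
  rw [smul_conj] at this
  have e : conj α.symm (conj α (α h • δ)) = α h • δ := conj_conj_symm α.symm _
  rwa [e] at this

/-! ### Vector fields on a smooth variety -/

open KaehlerDifferential in
/-- On a smooth variety, the module of vector fields has a dual frame with respect to finitely
many differential forms. -/
theorem exists_frame [Algebra.Smooth ℂ A] : ∃ (n : ℕ) (e : Fin n → Ω[A⁄ℂ]) (d : Fin n → VFalg A),
    ∀ δ : VFalg A, δ = ∑ i, δ.liftKaehlerDifferential (e i) • d i := by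
  -- Smoothness makes the differentials finite projective, hence a direct summand of a free module;
  -- the frame consists of the coordinates of that embedding.
  obtain ⟨n, u, v, -, -, huv⟩ := Module.Finite.exists_comp_eq_id_of_projective A Ω[A⁄ℂ]
  refine ⟨n, fun i => u (Pi.single i 1),
    fun i => linearMapEquivDerivation ℂ A (LinearMap.proj i ∘ₗ v), fun δ => ?_⟩
  ext f
  have h₁ : δ f = δ.liftKaehlerDifferential (u (v (D ℂ A f))) := by
    have := LinearMap.congr_fun huv (D ℂ A f)
    simp only [LinearMap.comp_apply, LinearMap.id_apply] at this
    simp [this]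
  have h₂ (w : Fin n → A) : u w = ∑ i, w i • u (Pi.single i 1) := by
    conv_lhs => rw [pi_eq_sum_univ' w]
    simp only [map_sum, map_smul]
  rw [h₁, h₂, map_sum, ← Derivation.coeFnAddMonoidHom_apply (∑ i, _), map_sum, Finset.sum_apply]
  refine Finset.sum_congr rfl fun i _ => ?_
  simp only [map_smul, smul_eq_mul, Derivation.coeFnAddMonoidHom_apply, Derivation.smul_apply]
  exact mul_comm _ _

theorem finite_vectorFields [Algebra.Smooth ℂ A] : Module.Finite A (VFalg A) := by
  classical
  obtain ⟨n, e, d, h⟩ := exists_frame (A := A)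
  refine ⟨⟨Finset.univ.image d, eq_top_iff.mpr fun δ _ => ?_⟩⟩
  rw [h δ]
  exact sum_mem fun i _ => Submodule.smul_mem _ _ (Submodule.subset_span (by simp))

/-- On a smooth variety, a vector field vanishing at `x` is a combination of vector fields with
coefficients in the maximal ideal of `x`. -/
theorem mem_ker_smul_top [Algebra.Smooth ℂ A] {x : Point A} {δ : VFalg A}
    (h : ∀ f, x (δ f) = 0) : δ ∈ RingHom.ker x • (⊤ : Submodule A (VFalg A)) := by
  obtain ⟨n, e, d, hd⟩ := exists_frame (A := A)
  rw [hd δ]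
  refine sum_mem fun i _ => Submodule.smul_mem_smul ?_ trivial
  -- Exact differentials generate all forms, so contracting any form with `δ` gives a function
  -- vanishing at `x`.
  have : (⊤ : Submodule A Ω[A⁄ℂ]) ≤
      Submodule.comap δ.liftKaehlerDifferential (RingHom.ker x : Ideal A) := by
    rw [← KaehlerDifferential.span_range_derivation, Submodule.span_le]
    rintro _ ⟨f, rfl⟩
    simpa using h f
  exact this (Submodule.mem_top (x := e i))

/-- If vector fields in `S` span the tangent space at `x`, then they generate all vector fields
near `x`. -/
theorem exists_smul_mem_span [Algebra.Smooth ℂ A] {x : Point A} {S : Set (VFalg A)}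
    (hS : Submodule.span ℂ ((valueAt · x) '' S) = ⊤) :
    ∃ s : A, s ≠ 0 ∧ ∀ δ : VFalg A, s • δ ∈ Submodule.span A S := by
  let ev : VFalg A →ₗ[ℂ] tangentSpace x :=
    { toFun := (valueAt · x)
      map_add' := fun δ η => by ext f; simp [valueAt]
      map_smul' := fun c δ => by ext f; simp [valueAt] }
  have := finite_vectorFields (A := A)
  -- Nakayama's lemma at the maximal ideal of `x`. The resulting `s` takes the value 1 at `x`, hence
  -- is nonzero.
  obtain ⟨s, hs, hle⟩ := Submodule.exists_sub_one_mem_and_smul_le_of_fg_of_le_sup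
    (I := RingHom.ker x) (N := Submodule.span A S) (P := ⊤) (Module.Finite.fg_top (R := A)) le_rfl
    (fun δ _ => by
      have hδ : ev δ ∈ Submodule.span ℂ (ev '' S) := hS ▸ Submodule.mem_top
      rw [← Submodule.map_span] at hδ
      obtain ⟨η, hη, hev⟩ := hδ
      rw [← sub_add_cancel δ η, add_comm]
      refine Submodule.add_mem_sup (Submodule.span_le_restrictScalars ℂ A S hη)
        (mem_ker_smul_top fun f => ?_)
      have := LinearMap.congr_fun (congrArg Subtype.val hev) f
      change x (η f) = x (δ f) at this
      simp [this])
  refine ⟨s, ?_, fun δ => hle (Submodule.smul_mem_pointwise_smul δ s ⊤ trivial)⟩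
  rintro rfl
  simp [RingHom.mem_ker] at hs

/-- Over a domain, if each member of `S` has a nonzero multiple in `N`, then so has each member of
the span of `S`. -/
theorem exists_smul_mem_of_mem_span {R : Type*} [CommRing R] [IsDomain R] {M : Type*} [AddCommGroup M] [Module R M]
    {N : Submodule R M} {S : Set M} (hS : ∀ v ∈ S, ∃ g : R, g ≠ 0 ∧ g • v ∈ N) {v : M}
    (hv : v ∈ Submodule.span R S) : ∃ g : R, g ≠ 0 ∧ g • v ∈ N := by
  induction hv using Submodule.span_induction with
  | mem v hv => exact hS v hv
  | zero => exact ⟨1, one_ne_zero, by simp⟩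
  | add v w _ _ hv hw =>
    obtain ⟨g, hg, hgv⟩ := hv
    obtain ⟨k, hk, hkw⟩ := hw
    refine ⟨k * g, mul_ne_zero hk hg, ?_⟩
    rw [smul_add]
    refine add_mem ?_ ?_
    · rw [mul_smul]
      exact N.smul_mem k hgv
    · rw [mul_comm, mul_smul]
      exact N.smul_mem g hkw
  | smul f v _ hv =>
    obtain ⟨g, hg, hgv⟩ := hv
    refine ⟨g, hg, ?_⟩
    rw [smul_comm]
    exact N.smul_mem f hgv

theorem exists_smul_mem_of_fg {R : Type*} [CommRing R] [IsDomain R] {M : Type*} [AddCommGroup M] [Module R M]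
    {N P : Submodule R M} (hP : P.FG) (h : ∀ v ∈ P, ∃ g : R, g ≠ 0 ∧ g • v ∈ N) :
    ∃ g : R, g ≠ 0 ∧ ∀ v ∈ P, g • v ∈ N := by
  classical
  obtain ⟨T, rfl⟩ := hP
  choose! g hg hgN using h
  -- A common denominator for the finitely many generators.
  refine ⟨∏ v ∈ T, g v, Finset.prod_ne_zero_iff.mpr fun v hv =>
    hg v (Submodule.subset_span hv), fun v hv => ?_⟩
  induction hv using Submodule.span_induction with
  | mem v hv =>
    rw [← Finset.mul_prod_erase T g hv, mul_comm, mul_smul]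
    exact N.smul_mem _ (hgN v (Submodule.subset_span hv))
  | zero => simp
  | add v w _ _ hv hw =>
    rw [smul_add]
    exact add_mem hv hw
  | smul f v _ hv =>
    rw [smul_comm]
    exact N.smul_mem f hv

/-- If each vector field of a family spanning a tangent space has a nonzero multiple in
`lieCore A`, then the conductor is nonzero. -/
theorem conductor_ne_bot [IsDomain A] [Algebra.Smooth ℂ A] {x : Point A} {S : Set (VFalg A)}
    (hspan : Submodule.span ℂ ((valueAt · x) '' S) = ⊤)
    (hS : ∀ δ ∈ S, ∃ g : A, g ≠ 0 ∧ g • δ ∈ lieCore A) : conductor A ≠ ⊥ := by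
  obtain ⟨s, hs, hspan'⟩ := exists_smul_mem_span hspan
  have := finite_vectorFields (A := A)
  obtain ⟨g, hg, hgN⟩ := exists_smul_mem_of_fg (N := lieCore A)
    (Module.Finite.fg_top (R := A) (M := VFalg A)) fun δ _ => by
      obtain ⟨k, hk, hkN⟩ := exists_smul_mem_of_mem_span hS (hspan' δ)
      exact ⟨k * s, mul_ne_zero hk hs, by rwa [mul_smul]⟩
  exact (Submodule.ne_bot_iff _).mpr ⟨g, mem_conductor.mpr fun δ => hgN δ trivial, hg⟩

theorem lieCore_eq_top_of_conductor_ne_bot [IsDomain A] [Algebra.FiniteType ℂ A]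
    (homog : IsHomogeneous A) (h : conductor A ≠ ⊥) : lieCore A = ⊤ := by
  have htop := eq_top_of_isHomogeneous homog h fun α f hf => map_mem_conductor α hf
  refine eq_top_iff.mpr fun δ _ => ?_
  simpa using mem_conductor.mp ((Ideal.eq_top_iff_one _).mp htop) δ

/-- The transports, by the automorphisms fixing `x`, of vector fields whose values form a generating
set at `x` span the tangent space at `x`. -/
theorem IsGeneratingSet.span_conj_eq_top {ι : Type*} {x : Point A} {δ : ι → VFalg A}
    (gen : IsGeneratingSet x (Set.range fun k => valueAt (δ k) x)) :
    Submodule.span ℂ ((valueAt · x) '' {θ | ∃ α k, θ = conj α (δ k)}) = ⊤ := by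
  rw [eq_top_iff, ← gen.2, Submodule.span_le]
  rintro w ⟨α, hα, _, ⟨k, rfl⟩, hw⟩
  refine Submodule.subset_span ⟨conj α (δ k), ⟨α, k, rfl⟩, ?_⟩
  ext f
  rw [hw]
  change x (α.symm (δ k (α f))) = x (δ k (α f))
  -- Since `α` fixes `x`, evaluating at `x` absorbs `α.symm`.
  conv_lhs => rw [← hα]
  simp [act]

end AffineDensity

theorem theorem2p8 {A : Type*} [CommRing A] [IsDomain A] [Algebra ℂ A] [Algebra.Smooth ℂ A]
    (homog : AffineDensity.IsHomogeneous A)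
    (m : ℕ) (hm : 0 < m) (δ₁ δ₂ : Fin m → AffineDensity.VFalg A)
    (compat : ∀ k, AffineDensity.Compatible (δ₁ k) (δ₂ k))
    (x₀ : AffineDensity.Point A)
    (gen : AffineDensity.IsGeneratingSet x₀
      (Set.range fun k => AffineDensity.valueAt (δ₂ k) x₀)) :
    (∃ L : Submodule A (AffineDensity.VFalg A),
        L ≠ ⊥ ∧ ∀ δ ∈ L, δ ∈ AffineDensity.LieAlg A) ∧
      AffineDensity.AlgebraicDensityProperty A := by
  have htop : AffineDensity.lieCore A = ⊤ := by
    refine AffineDensity.lieCore_eq_top_of_conductor_ne_bot homog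
      (AffineDensity.conductor_ne_bot gen.span_conj_eq_top ?_)
    rintro _ ⟨α, k, rfl⟩
    obtain ⟨g, hg, hgN⟩ := (compat k).exists_smul_mem_lieCore
    -- By `smul_conj` a coefficient passes inside the transport through `α`, so `α.symm g` becomes
    -- `g`.
    refine ⟨α.symm g, by simpa using hg, ?_⟩
    rw [AffineDensity.smul_conj, AlgEquiv.apply_symm_apply]
    exact AffineDensity.conj_mem_lieCore α hgN
  refine ⟨⟨AffineDensity.lieCore A, ?_, fun δ => AffineDensity.mem_lieAlg_of_mem_lieCore⟩,
    eq_top_iff.mpr fun δ _ => AffineDensity.mem_lieAlg_of_mem_lieCore (htop ▸ Submodule.mem_top)⟩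
  -- The core is everything, so it is nonzero as soon as one nonzero field exists; `0 < m` supplies
  -- one.
  exact (Submodule.ne_bot_iff _).mpr
    ⟨δ₂ ⟨0, hm⟩, htop ▸ Submodule.mem_top, (compat ⟨0, hm⟩).ne_zero₂⟩
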